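/- Let $n\ge 2$, let $x\in\mathbb{R}^n$ and $r>0$, and let $B^n(x,r)=\{y\in\mathbb{R}^n:|y-x|<r\}$. A function $u$ on a proper subdomain $G\subsetneq\mathbb{R}^n$ (a nonempty connected open set) is said to satisfy the $(s,C(s))$-Harnack inequality in $G$, where $s\in(0,1)$ and $C(s)\ge 1$, if $u$ is continuous and nonnegative on $G$ and $$\max_{\overline{B}^n(y,s\rho)} u\;\le\; C(s)\,\min_{\overline{B}^n(y,s\rho)} u$$ for all $y\in\mathbb{R}^n$ and $\rho>0$ with $B^n(y,\rho)\subset G$. It is called an $(s,C(s))$-Harnack function in $G$ if this holds for every $s\in(0,1)$. Every positive harmonic function $u:B^n(x,r)\to(0,\infty)$ (that is, $u$ is twice continuously differentiable with $\sum_{i=1}^n\partial^2u/\partial x_i^2=0$) is an $(s,C(s))$-Harnack function in $B^n(x,r)$ with $$C(s)=C(s,n)=\frac{1}{1-s^2}\left(\frac{1+s}{1-s}\right)^n,\qquad s\in(0,1).$$ -/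

import Mathlib

/-- A proper subdomain of `ℝⁿ`: a nonempty, connected, open set different from `ℝⁿ`. -/
def IsProperSubdomain {n : ℕ} (G : Set (EuclideanSpace ℝ (Fin n))) : Prop :=
  IsOpen G ∧ IsConnected G ∧ G ≠ Set.univ

/-- `u` satisfies the `(s, C)`-Harnack inequality in `G`: here `G` is a proper subdomain of `ℝⁿ`,
`u` is continuous and nonnegative on `G`, `s ∈ (0,1)`, `C ≥ 1`, and
`max_B u ≤ C * min_B u` for the closed ball `B` of centre `y` and radius `s * ρ`
whenever the open ball of centre `y` and radius `ρ > 0` is contained in `G`.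
The maximum and the minimum are attained values of `u` on `B`.
The values of `u` outside `G` play no role. -/
structure SatisfiesHarnack {n : ℕ} (G : Set (EuclideanSpace ℝ (Fin n))) (s C : ℝ)
    (u : EuclideanSpace ℝ (Fin n) → ℝ) : Prop where
  domain : IsProperSubdomain G
  continuousOn : ContinuousOn u G
  nonneg : ∀ y ∈ G, 0 ≤ u y
  s_mem : s ∈ Set.Ioo (0 : ℝ) 1
  one_le : 1 ≤ C
  max_le_mul_min : ∀ (y : EuclideanSpace ℝ (Fin n)) (ρ : ℝ), 0 < ρ → Metric.ball y ρ ⊆ G →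
    ∃ M m : ℝ, IsGreatest (u '' Metric.closedBall y (s * ρ)) M ∧
      IsLeast (u '' Metric.closedBall y (s * ρ)) m ∧ M ≤ C * m

/-- `u` is an `(s, C(s))`-Harnack function in `G`: it satisfies the `(s, C(s))`-Harnack
inequality in `G` for every `s ∈ (0,1)`. -/
def IsHarnackFunction {n : ℕ} (G : Set (EuclideanSpace ℝ (Fin n))) (C : ℝ → ℝ)
    (u : EuclideanSpace ℝ (Fin n) → ℝ) : Prop :=
  ∀ s ∈ Set.Ioo (0 : ℝ) 1, SatisfiesHarnack G s (C s) u

/-!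
For `u` and `v` harmonic near the closed ball of radius `max a b`, the integral over the unit
sphere of `u (a ω) * v (b ω)` depends on `a` and `b` only through the product `a * b`: moving
along `(exp t, exp (s - t))` its derivative is the flux in Green's identity for two dilates of `u`
and `v`, and so vanishes. In particular `a` and `b` can be interchanged. With `v = 1` this is the
mean value property. With `v` the Poisson kernel `P_e`, it says that `u (ρ ω) * P_e (c ω)` and
`u (c ω) * P_e (ρ ω)` have the same average, which tends to `u (c e)` as `ρ → 1` because
`P_e (ρ ω)` is an approximate identity on the sphere. Bounding `P_e (c ω)` above and below and
using the mean value property compares `u (c e)` with `u 0`. At distance at most `s` from the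
centre the two bounds have quotient `((1 + s) / (1 - s)) ^ n`.
-/

open Filter InnerProductSpace Metric Module Set Topology MeasureTheory
open scoped Gradient Laplacian

section Divergence

variable {E : Type*} [NormedAddCommGroup E] [InnerProductSpace ℝ E]

/-- The divergence of the vector field `V` at `x`, encoded without coordinates as the trace of the
derivative; it is `0` where `V` is not differentiable. -/
noncomputable def divergence (V : E → E) (x : E) : ℝ :=
  LinearMap.trace ℝ E (fderiv ℝ V x)

theorem divergence_sub {V W : E → E} {x : E} (hV : DifferentiableAt ℝ V x)
    (hW : DifferentiableAt ℝ W x) :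
    divergence (fun y => V y - W y) x = divergence V x - divergence W x := by
  simp [divergence, fderiv_fun_sub hV hW]

theorem divergence_add {V W : E → E} {x : E} (hV : DifferentiableAt ℝ V x)
    (hW : DifferentiableAt ℝ W x) :
    divergence (fun y => V y + W y) x = divergence V x + divergence W x := by
  simp [divergence, fderiv_fun_add hV hW]

theorem divergence_congr_nhds {V W : E → E} {x : E} (h : V =ᶠ[𝓝 x] W) :
    divergence V x = divergence W x := by
  simp only [divergence, h.fderiv_eq]

theorem fderiv_comp_const_add_smul {F : Type*} [NormedAddCommGroup F] [NormedSpace ℝ F]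
    (f : E → F) (c : E) (a : ℝ) (x : E) :
    fderiv ℝ (fun y => f (c + a • y)) x = a • fderiv ℝ f (c + a • x) := by
  rw [← fderiv_comp_add_left c]
  exact fderiv_comp_smul (f := fun y => f (c + y)) a

theorem divergence_eq_sum {ι : Type*} [Fintype ι] (b : OrthonormalBasis ι ℝ E) (V : E → E)
    (x : E) : divergence V x = ∑ i, ⟪b i, fderiv ℝ V x (b i)⟫_ℝ :=
  LinearMap.trace_eq_sum_inner _ b

variable [FiniteDimensional ℝ E]

theorem divergence_sub_const (e x : E) : divergence (fun y => y - e) x = finrank ℝ E := by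
  simp only [divergence, fderiv_sub_const, fderiv_fun_id]
  exact LinearMap.trace_id ℝ E

theorem divergence_smul {f : E → ℝ} {V : E → E} {x : E} (hf : DifferentiableAt ℝ f x)
    (hV : DifferentiableAt ℝ V x) :
    divergence (fun y => f y • V y) x = ⟪∇ f x, V x⟫_ℝ + f x * divergence V x := by
  simp [divergence, fderiv_fun_smul hf hV, add_comm]

theorem gradient_eq_sum {ι : Type*} [Fintype ι] (b : OrthonormalBasis ι ℝ E) (f : E → ℝ) :
    ∇ f = fun x => ∑ i, fderiv ℝ f x (b i) • b i := by
  ext1 x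
  simp only [← inner_gradient_left, real_inner_comm (b _), b.sum_repr' (∇ f x)]

theorem contDiffAt_gradient {f : E → ℝ} {x : E} (hf : ContDiffAt ℝ 2 f x) :
    ContDiffAt ℝ 1 (∇ f) x := by
  rw [gradient_eq_sum (stdOrthonormalBasis ℝ E)]
  exact ContDiffAt.sum fun i _ =>
    ((hf.fderiv_right (by norm_num)).clm_apply contDiffAt_const).smul contDiffAt_const

theorem laplacian_eq_divergence_gradient {f : E → ℝ} {x : E} (hf : ContDiffAt ℝ 2 f x) :
    Δ f x = divergence (∇ f) x := by
  have hf' : DifferentiableAt ℝ (fderiv ℝ f) x :=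
    (hf.fderiv_right (m := 1) (by norm_num)).differentiableAt one_ne_zero
  have hgrad := (contDiffAt_gradient hf).differentiableAt one_ne_zero
  rw [laplacian_eq_iteratedFDeriv_orthonormalBasis f (stdOrthonormalBasis ℝ E),
    divergence_eq_sum (stdOrthonormalBasis ℝ E)]
  refine Finset.sum_congr rfl fun i _ => ?_
  set e := stdOrthonormalBasis ℝ E i
  have hcomp : (fun y => ⟪e, ∇ f y⟫_ℝ) = fun y => fderiv ℝ f y e := by
    ext1 y
    rw [real_inner_comm, inner_gradient_left]
  calc iteratedFDeriv ℝ 2 f x ![e, e] = fderiv ℝ (fun y => fderiv ℝ f y e) x e := by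
        simp [iteratedFDeriv_two_apply, fderiv_clm_apply hf' (differentiableAt_const e)]
    _ = ⟪e, fderiv ℝ (∇ f) x e⟫_ℝ := by
        rw [← hcomp, fderiv_inner_apply ℝ (differentiableAt_const e) hgrad]
        simp

theorem gradient_mul {f g : E → ℝ} {x : E} (hf : DifferentiableAt ℝ f x)
    (hg : DifferentiableAt ℝ g x) :
    ∇ (fun y => f y * g y) x = f x • ∇ g x + g x • ∇ f x := by
  simp [gradient, fderiv_fun_mul hf hg]

theorem divergence_smul_gradient {f g : E → ℝ} {x : E} (hf : DifferentiableAt ℝ f x)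
    (hg : ContDiffAt ℝ 2 g x) :
    divergence (fun y => f y • ∇ g y) x = ⟪∇ f x, ∇ g x⟫_ℝ + f x * Δ g x := by
  rw [divergence_smul hf ((contDiffAt_gradient hg).differentiableAt one_ne_zero),
    laplacian_eq_divergence_gradient hg]

theorem laplacian_mul {f g : E → ℝ} {x : E} (hf : ContDiffAt ℝ 2 f x) (hg : ContDiffAt ℝ 2 g x) :
    Δ (fun y => f y * g y) x = f x * Δ g x + 2 * ⟪∇ f x, ∇ g x⟫_ℝ + g x * Δ f x := by
  have hf1 := hf.differentiableAt two_ne_zero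
  have hg1 := hg.differentiableAt two_ne_zero
  have hf2 := (contDiffAt_gradient hf).differentiableAt one_ne_zero
  have hg2 := (contDiffAt_gradient hg).differentiableAt one_ne_zero
  have hgrad : ∇ (fun y => f y * g y) =ᶠ[𝓝 x] fun y => f y • ∇ g y + g y • ∇ f y := by
    filter_upwards [hf.eventually (by norm_num), hg.eventually (by norm_num)] with y hfy hgy
    exact gradient_mul (hfy.differentiableAt two_ne_zero) (hgy.differentiableAt two_ne_zero)
  rw [laplacian_eq_divergence_gradient (hf.mul hg), divergence_congr_nhds hgrad,
    divergence_add (hf1.fun_smul hg2) (hg1.fun_smul hf2), divergence_smul_gradient hf1 hg,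
    divergence_smul_gradient hg1 hf, real_inner_comm (∇ f x)]
  ring

theorem laplacian_comp_const_add_smul {f : E → ℝ} {c : E} {a : ℝ} {x : E}
    (hf : ContDiffAt ℝ 2 f (c + a • x)) :
    Δ (fun y => f (c + a • y)) x = a ^ 2 * Δ f (c + a • x) := by
  have hcomp : ContDiffAt ℝ 2 (fun y => f (c + a • y)) x := hf.comp x (by fun_prop)
  have hgrad : ∇ (fun y => f (c + a • y)) = a • fun y => ∇ f (c + a • y) := by
    ext1 y
    simp [gradient, fderiv_comp_const_add_smul]
  rw [laplacian_eq_divergence_gradient hcomp, laplacian_eq_divergence_gradient hf, hgrad]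
  rw [divergence, fderiv_const_smul_field, Pi.smul_apply, fderiv_comp_const_add_smul (∇ f)]
  simp [divergence, sq, mul_assoc]

theorem harmonicOnNhd_comp_const_add_smul {f : E → ℝ} {s : Set E} (hf : HarmonicOnNhd f s)
    (c : E) (a : ℝ) : HarmonicOnNhd (fun x => f (c + a • x)) ((fun x => c + a • x) ⁻¹' s) := by
  intro x hx
  obtain ⟨hdiff, hΔ⟩ := hf _ hx
  have hc : ContinuousAt (fun x : E => c + a • x) x := by fun_prop
  refine ⟨hdiff.comp x (f := fun x : E => c + a • x) (by fun_prop), ?_⟩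
  filter_upwards [hc.eventually hΔ, hc.eventually (hdiff.eventually (by norm_num))] with y hy hy'
  rw [laplacian_comp_const_add_smul hy', hy]
  simp

theorem integral_fderiv_apply_eq_zero {F : Type*} [NormedAddCommGroup F] [NormedSpace ℝ F]
    [MeasurableSpace E] [BorelSpace E] (μ : Measure E)
    [μ.IsAddHaarMeasure] {V : E → F} (hV : ContDiff ℝ 1 V) (hVc : HasCompactSupport V) (v : E) :
    ∫ x, fderiv ℝ V x v ∂μ = 0 := by
  have hV' : Continuous fun x => fderiv ℝ V x v :=
    (hV.continuous_fderiv one_ne_zero).clm_apply continuous_const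
  have hV'c : HasCompactSupport fun x => fderiv ℝ V x v := hVc.fderiv_apply ℝ v
  simpa using integral_smul_fderiv_eq_neg_fderiv_smul_of_integrable (μ := μ) (v := v)
    (f := fun _ => (1 : ℝ)) (g := V) (by simp)
    (by simpa using hV'.integrable_of_hasCompactSupport hV'c)
    (by simpa using hV.continuous.integrable_of_hasCompactSupport hVc)
    (fun x _ => by fun_prop) (fun x _ => hV.differentiable one_ne_zero x)

theorem integral_divergence_eq_zero [MeasurableSpace E] [BorelSpace E] (μ : Measure E)
    [μ.IsAddHaarMeasure] {V : E → E} (hV : ContDiff ℝ 1 V) (hVc : HasCompactSupport V) :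
    ∫ x, divergence V x ∂μ = 0 := by
  set b := stdOrthonormalBasis ℝ E
  have hint (i) : Integrable (fun x => fderiv ℝ V x (b i)) μ :=
    ((hV.continuous_fderiv one_ne_zero).clm_apply
      continuous_const).integrable_of_hasCompactSupport (hVc.fderiv_apply ℝ (b i))
  simp only [divergence_eq_sum b]
  rw [integral_finsetSum _ fun i _ => (hint i).const_inner (b i)]
  refine Finset.sum_eq_zero fun i _ => ?_
  rw [integral_inner (hint i), integral_fderiv_apply_eq_zero μ hV hVc, inner_zero_right]

end Divergence

theorem integral_volumeIoiPow {F : Type*} [NormedAddCommGroup F] [NormedSpace ℝ F] (n : ℕ)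
    (f : ℝ → F) :
    ∫ ρ : Ioi (0 : ℝ), f ρ ∂.volumeIoiPow n = ∫ ρ in Ioi (0 : ℝ), ρ ^ n • f ρ := by
  simp only [Measure.volumeIoiPow, ENNReal.ofReal]
  rw [integral_withDensity_eq_integral_smul (measurable_subtype_coe.pow_const _).real_toNNReal,
    integral_subtype_comap measurableSet_Ioi fun ρ => (ρ ^ n).toNNReal • f ρ]
  refine setIntegral_congr_fun measurableSet_Ioi fun ρ hρ => ?_
  simp only [NNReal.smul_def, Real.coe_toNNReal _ (pow_nonneg (mem_Ioi.1 hρ).le _)]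

theorem exists_forall_lt_eq_zero_of_tsupport_subset {F : Type*} [Zero F] {k : ℝ → F} {a b : ℝ}
    (hab : a < b) (hk : HasCompactSupport k) (hks : tsupport k ⊆ Ioo a b) :
    ∃ c ∈ Ico a b, ∀ t, c < t → k t = 0 := by
  obtain hempty | hne := (tsupport k).eq_empty_or_nonempty
  · exact ⟨a, ⟨le_rfl, hab⟩, fun t _ => image_eq_zero_of_notMem_tsupport (by simp [hempty])⟩
  · obtain ⟨c, hc, hmax⟩ := hk.isCompact.exists_isGreatest hne
    exact ⟨c, Ioo_subset_Ico_self (hks hc), fun t hct =>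
      image_eq_zero_of_notMem_tsupport fun h => hct.not_ge (hmax h)⟩

section Flux

variable {E : Type*} [NormedAddCommGroup E] [InnerProductSpace ℝ E]

theorem smul_sphere_mem_ball {a R : ℝ} (ha : a ∈ Ioo (-R) R) (ω : sphere (0 : E) 1) :
    a • (ω : E) ∈ ball (0 : E) R := by
  simpa [norm_smul, abs_lt] using ha

theorem continuousOn_comp_smul_sphere {F : Type*} [TopologicalSpace F] {R : ℝ} {f : E → F}
    (hf : ContinuousOn f (ball 0 R)) {α : ℝ → ℝ} (hα : Continuous α) {s : Set ℝ}
    (hαs : MapsTo α s (Ioo (-R) R)) :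
    ContinuousOn (fun p : ℝ × sphere (0 : E) 1 => f (α p.1 • (p.2 : E))) (s ×ˢ univ) :=
  hf.comp (by fun_prop) fun p hp => smul_sphere_mem_ball (hαs hp.1) p.2

theorem hasGradientAt_integral_norm_sq [CompleteSpace E] {k : ℝ → ℝ} (hk : Continuous k)
    (c : ℝ) (x : E) :
    HasGradientAt (fun x => (1 / 2) * ∫ t in c..‖x‖ ^ 2, k (√t)) (k ‖x‖ • x) x := by
  have hint := (show Continuous fun t => k (√t) by fun_prop).integral_hasStrictDerivAt c (‖x‖ ^ 2)
  have hcomp := hint.hasDerivAt.comp_hasFDerivAt x (hasStrictFDerivAt_norm_sq x).hasFDerivAt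
  rw [hasGradientAt_iff_hasFDerivAt]
  refine (hcomp.const_mul (1 / 2)).congr_fderiv ?_
  ext y
  simp
  ring

variable [FiniteDimensional ℝ E]

theorem exists_contDiff_hasGradientAt_norm_smul {k : ℝ → ℝ} (hk : Continuous k) {a : ℝ}
    (ha : 0 ≤ a) (hka : ∀ t, a < t → k t = 0) :
    ∃ Q : E → ℝ, ContDiff ℝ 1 Q ∧ (∀ x, HasGradientAt Q (k ‖x‖ • x) x) ∧
      ∀ x, a < ‖x‖ → Q x = 0 := by
  set Q : E → ℝ := fun x => (1 / 2) * ∫ t in a ^ 2..‖x‖ ^ 2, k (√t)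
  have hQ (x : E) : HasGradientAt Q (k ‖x‖ • x) x := hasGradientAt_integral_norm_sq hk _ x
  refine ⟨Q, contDiff_one_iff_fderiv.2 ⟨fun x => (hQ x).differentiableAt, ?_⟩, hQ, fun x hx => ?_⟩
  · have hderiv : fderiv ℝ Q = fun x => toDual ℝ E (k ‖x‖ • x) :=
      funext fun x => (hQ x).hasFDerivAt.fderiv
    have hdual := (toDual ℝ E).continuous
    rw [hderiv]
    fun_prop
  · have hzero : ∀ t ∈ Ioo (a ^ 2) (‖x‖ ^ 2), k (√t) = 0 := fun t ht =>
      hka _ (Real.lt_sqrt_of_sq_lt ht.1)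
    have hle : a ^ 2 ≤ ‖x‖ ^ 2 := by gcongr
    simp only [Q]
    rw [intervalIntegral.integral_of_le hle, integral_Ioc_eq_integral_Ioo,
      setIntegral_congr_fun measurableSet_Ioo hzero, integral_zero, mul_zero]

variable [MeasurableSpace E] [BorelSpace E] (μ : Measure E) [μ.IsAddHaarMeasure]

/- The weight `k ‖x‖ • x` is the gradient of a compactly supported function `Q`, so the integrand is
the divergence of `Q • W`. -/
theorem integral_norm_mul_inner_eq_zero_of_divergence_eq_zero {W : E → E} {R : ℝ}
    (hW : ContDiffOn ℝ 1 W (ball 0 R)) (hdiv : ∀ x ∈ ball 0 R, divergence W x = 0) {k : ℝ → ℝ}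
    (hk : Continuous k) {a : ℝ} (ha : 0 ≤ a) (haR : a < R) (hka : ∀ t, a < t → k t = 0) :
    ∫ x, k ‖x‖ * ⟪x, W x⟫_ℝ ∂μ = 0 := by
  obtain ⟨Q, hQ1, hQ, hQ0⟩ := exists_contDiff_hasGradientAt_norm_smul (E := E) hk ha hka
  have hWx (x) (hx : x ∈ ball (0 : E) R) : ContDiffAt ℝ 1 W x :=
    hW.contDiffAt (isOpen_ball.mem_nhds hx)
  have hout (x) (hx : x ∉ ball (0 : E) R) : a < ‖x‖ := haR.trans_le (by simpa using hx)
  have hV0 (x) (hx : x ∉ ball (0 : E) R) : (fun y => Q y • W y) =ᶠ[𝓝 x] 0 := by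
    filter_upwards [continuous_norm.continuousAt.eventually_const_lt (hout x hx)] with y hy
    simp [hQ0 y hy]
  have hV : ContDiff ℝ 1 fun x => Q x • W x := contDiff_iff_contDiffAt.2 fun x => by
    by_cases hx : x ∈ ball (0 : E) R
    · exact hQ1.contDiffAt.smul (hWx x hx)
    · exact contDiffAt_const.congr_of_eventuallyEq (hV0 x hx)
  have hVc : HasCompactSupport fun x => Q x • W x :=
    HasCompactSupport.intro (isCompact_closedBall (0 : E) a) fun x hx => by
      rw [hQ0 x (by simpa using hx), zero_smul]
  rw [← integral_divergence_eq_zero μ hV hVc]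
  refine integral_congr_ae (.of_forall fun x => ?_)
  by_cases hx : x ∈ ball (0 : E) R
  · simp [divergence_smul (hQ x).differentiableAt ((hWx x hx).differentiableAt one_ne_zero),
      hdiv x hx, (hQ x).gradient, inner_smul_left]
  · rw [divergence_congr_nhds (hV0 x hx)]
    simp [hka _ (hout x hx), divergence]

theorem integral_eq_integral_Ioi_integral_sphere {F : Type*} [NormedAddCommGroup F]
    [NormedSpace ℝ F] [Nontrivial E] {f : E → F} (hf : Integrable f μ) :
    ∫ x, f x ∂μ = ∫ ρ in Ioi (0 : ℝ), ρ ^ (finrank ℝ E - 1) •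
        ∫ ω : sphere (0 : E) 1, f (ρ • (ω : E)) ∂μ.toSphere := by
  have hmp := μ.measurePreserving_homeomorphUnitSphereProd.symm
    (homeomorphUnitSphereProd E).toMeasurableEquiv
  have hemb := (homeomorphUnitSphereProd E).toMeasurableEquiv.symm.measurableEmbedding
  have hf' : Integrable (fun x : ({0}ᶜ : Set E) => f x) (μ.comap (↑)) := by
    refine (integrableOn_iff_comap_subtypeVal (measurableSet_singleton _).compl).1 ?_
    rwa [IntegrableOn, restrict_compl_singleton]
  calc ∫ x, f x ∂μ = ∫ x : ({0}ᶜ : Set E), f x ∂(μ.comap (↑)) := by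
        rw [integral_subtype_comap (measurableSet_singleton _).compl f, restrict_compl_singleton]
    _ = ∫ p : sphere (0 : E) 1 × Ioi (0 : ℝ), f ((p.2 : ℝ) • (p.1 : E))
          ∂μ.toSphere.prod (.volumeIoiPow (finrank ℝ E - 1)) :=
        (hmp.integral_comp hemb fun x => f x).symm
    _ = ∫ ρ : Ioi (0 : ℝ), ∫ ω : sphere (0 : E) 1, f ((ρ : ℝ) • (ω : E)) ∂μ.toSphere
          ∂.volumeIoiPow (finrank ℝ E - 1) :=
        integral_prod_symm _ ((hmp.integrable_comp_emb hemb).2 hf')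
    _ = _ :=
        integral_volumeIoiPow _ fun ρ => ∫ ω : sphere (0 : E) 1, f (ρ • (ω : E)) ∂μ.toSphere

theorem continuousOn_integral_sphere {F : Type*} [NormedAddCommGroup F] [NormedSpace ℝ F] {R : ℝ}
    {f : E → F} (hf : ContinuousOn f (ball 0 R)) :
    ContinuousOn (fun ρ : ℝ => ∫ ω : sphere (0 : E) 1, f (ρ • (ω : E)) ∂μ.toSphere)
      (Ioo (-R) R) :=
  continuousOn_integral_of_compact_support isCompact_univ
    (continuousOn_comp_smul_sphere hf continuous_id (mapsTo_id _)) (by simp)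

theorem integral_Ioi_mul_integral_sphere_inner_eq_zero_of_divergence_eq_zero [Nontrivial E]
    {W : E → E} {R : ℝ} (hW : ContDiffOn ℝ 1 W (ball 0 R))
    (hdiv : ∀ x ∈ ball 0 R, divergence W x = 0) {k : ℝ → ℝ} (hk : Continuous k) {a : ℝ}
    (ha : 0 ≤ a) (haR : a < R) (hka : ∀ t, a < t → k t = 0) :
    ∫ t in Ioi (0 : ℝ), k t * (t ^ (finrank ℝ E - 1) *
      ∫ ω : sphere (0 : E) 1, ⟪t • (ω : E), W (t • (ω : E))⟫_ℝ ∂μ.toSphere) = 0 := by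
  have hcont : ContinuousOn (fun x => k ‖x‖ * ⟪x, W x⟫_ℝ) (closedBall 0 a) := by
    have hWa := hW.continuousOn.mono (closedBall_subset_ball haR)
    fun_prop
  have hsupp : (Function.support fun x => k ‖x‖ * ⟪x, W x⟫_ℝ) ⊆ closedBall 0 a := fun x hx => by
    rw [mem_closedBall_zero_iff]
    exact not_lt.1 fun hax => hx (by simp [hka _ hax])
  have hint : Integrable (fun x => k ‖x‖ * ⟪x, W x⟫_ℝ) μ :=
    (integrableOn_iff_integrable_of_support_subset hsupp).1
      (hcont.integrableOn_compact (isCompact_closedBall 0 a))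
  refine Eq.trans ?_ (integral_norm_mul_inner_eq_zero_of_divergence_eq_zero μ hW hdiv hk ha haR hka)
  rw [integral_eq_integral_Ioi_integral_sphere μ hint]
  refine setIntegral_congr_fun measurableSet_Ioi fun t (ht : 0 < t) => ?_
  simp only [norm_smul, norm_eq_of_mem_sphere, mul_one, Real.norm_of_nonneg ht.le,
    integral_const_mul, smul_eq_mul]
  ring

theorem integral_sphere_inner_eq_zero_of_divergence_eq_zero [Nontrivial E] {W : E → E} {R : ℝ}
    (hW : ContDiffOn ℝ 1 W (ball 0 R)) (hdiv : ∀ x ∈ ball 0 R, divergence W x = 0) {ρ : ℝ}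
    (hρ : ρ ∈ Ioo 0 R) :
    ∫ ω : sphere (0 : E) 1, ⟪(ω : E), W (ρ • (ω : E))⟫_ℝ ∂μ.toSphere = 0 := by
  set g : ℝ → ℝ := fun t => t ^ (finrank ℝ E - 1) *
    ∫ ω : sphere (0 : E) 1, ⟪t • (ω : E), W (t • (ω : E))⟫_ℝ ∂μ.toSphere with hg
  have hinner : ContinuousOn (fun x => ⟪x, W x⟫_ℝ) (ball 0 R) :=
    continuousOn_id.inner (𝕜 := ℝ) hW.continuousOn
  have hcont : ContinuousOn g (Ioo 0 R) :=
    (continuous_pow _).continuousOn.mul ((continuousOn_integral_sphere μ hinner).mono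
      (Ioo_subset_Ioo_left (neg_nonpos.2 (hρ.1.trans hρ.2).le)))
  have hzero : ∀ᵐ t, t ∈ Ioo 0 R → g t = 0 := by
    refine isOpen_Ioo.ae_eq_zero_of_integral_contDiff_smul_eq_zero
      (hcont.locallyIntegrableOn measurableSet_Ioo) fun k hk hkc hks => ?_
    have hk0 (t) (ht : t ∉ Ioo 0 R) : k t = 0 :=
      image_eq_zero_of_notMem_tsupport fun h => ht (hks h)
    obtain ⟨a, ha, hka⟩ := exists_forall_lt_eq_zero_of_tsupport_subset (hρ.1.trans hρ.2) hkc hks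
    rw [← integral_Ioi_mul_integral_sphere_inner_eq_zero_of_divergence_eq_zero μ hW hdiv
      hk.continuous ha.1 ha.2 hka]
    refine (setIntegral_eq_integral_of_forall_compl_eq_zero fun t ht => ?_).symm
    simp [hk0 t fun h => ht h.1]
  have hgρ : g ρ = 0 :=
    Measure.eqOn_open_of_ae_eq (μ := volume) ((ae_restrict_iff' measurableSet_Ioo).2 hzero)
      isOpen_Ioo hcont continuousOn_const hρ
  simpa [hg, inner_smul_left, integral_const_mul, hρ.1.ne'] using hgρ

theorem integral_sphere_green [Nontrivial E] {R : ℝ} {f g : E → ℝ}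
    (hf : HarmonicOnNhd f (ball 0 R)) (hg : HarmonicOnNhd g (ball 0 R)) {ρ : ℝ} (hρ : ρ ∈ Ioo 0 R) :
    ∫ ω : sphere (0 : E) 1, (fderiv ℝ f (ρ • (ω : E)) ω * g (ρ • (ω : E))
      - f (ρ • (ω : E)) * fderiv ℝ g (ρ • (ω : E)) ω) ∂μ.toSphere = 0 := by
  set W : E → E := fun x => g x • ∇ f x - f x • ∇ g x with hW
  have hW1 : ContDiffOn ℝ 1 W (ball 0 R) := fun x hx =>
    (((hg x hx).1.of_le one_le_two).smul (contDiffAt_gradient (hf x hx).1)).sub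
      (((hf x hx).1.of_le one_le_two).smul (contDiffAt_gradient (hg x hx).1)) |>.contDiffWithinAt
  have hdiv : ∀ x ∈ ball 0 R, divergence W x = 0 := fun x hx => by
    have hf1 := (hf x hx).1.differentiableAt two_ne_zero
    have hg1 := (hg x hx).1.differentiableAt two_ne_zero
    have hf2 := (contDiffAt_gradient (hf x hx).1).differentiableAt one_ne_zero
    have hg2 := (contDiffAt_gradient (hg x hx).1).differentiableAt one_ne_zero
    rw [hW, divergence_sub (hg1.fun_smul hf2) (hf1.fun_smul hg2),
      divergence_smul_gradient hg1 (hf x hx).1, divergence_smul_gradient hf1 (hg x hx).1,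
      real_inner_comm, (hf x hx).2.self_of_nhds, (hg x hx).2.self_of_nhds]
    simp
  refine Eq.trans ?_ (integral_sphere_inner_eq_zero_of_divergence_eq_zero μ hW1 hdiv hρ)
  refine integral_congr_ae (.of_forall fun ω => ?_)
  dsimp only
  rw [real_inner_comm]
  simp only [hW, inner_sub_left, real_inner_smul_left, inner_gradient_left]
  ring

end Flux

theorem hasDerivAt_integral_of_continuousOn_prod {X F : Type*} [TopologicalSpace X] [CompactSpace X]
    [MeasurableSpace X] [OpensMeasurableSpace X] [NormedAddCommGroup F] [NormedSpace ℝ F]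
    [SecondCountableTopologyEither X F]
    (ν : Measure X) [IsFiniteMeasure ν] {f f' : ℝ → X → F} {s : Set ℝ} (hs : IsOpen s)
    (hf : ∀ t ∈ s, Continuous (f t)) (hf' : ContinuousOn (fun p : ℝ × X => f' p.1 p.2) (s ×ˢ univ))
    (hderiv : ∀ t ∈ s, ∀ x, HasDerivAt (fun r => f r x) (f' t x) t) {t : ℝ} (ht : t ∈ s) :
    HasDerivAt (fun r => ∫ x, f r x ∂ν) (∫ x, f' t x ∂ν) t := by
  obtain ⟨ε, hε, hball⟩ := nhds_basis_closedBall.mem_iff.1 (hs.mem_nhds ht)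
  obtain ⟨C, hC⟩ := ((isCompact_closedBall t ε).prod isCompact_univ).exists_bound_of_continuousOn
    (hf'.mono (prod_mono hball subset_rfl))
  have hcont (r) (hr : r ∈ s) : Continuous (f' r) :=
    hf'.comp_continuous (by fun_prop : Continuous fun x => (r, x)) fun x => ⟨hr, mem_univ x⟩
  refine (hasDerivAt_integral_of_dominated_loc_of_deriv_le (F' := f') (bound := fun _ => C)
    (closedBall_mem_nhds t hε) ?_ ?_ ?_ ?_ (integrable_const C) ?_).2
  · filter_upwards [hs.mem_nhds ht] with r hr using (hf r hr).aestronglyMeasurable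
  · exact (hf t ht).integrable_of_hasCompactSupport (HasCompactSupport.of_compactSpace _)
  · exact (hcont t ht).aestronglyMeasurable
  · exact .of_forall fun x r hr => hC (r, x) ⟨hr, mem_univ x⟩
  · exact .of_forall fun x r hr => hderiv r (hball hr) x

section Swap

variable {E : Type*} [NormedAddCommGroup E] [InnerProductSpace ℝ E]

theorem hasDerivAt_comp_smul {f : E → ℝ} {α : ℝ → ℝ} {α' t : ℝ} {x : E}
    (hf : DifferentiableAt ℝ f (α t • x)) (hα : HasDerivAt α α' t) :
    HasDerivAt (fun r => f (α r • x)) (α' * fderiv ℝ f (α t • x) x) t := by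
  refine (hf.hasFDerivAt.comp_hasDerivAt t (hα.smul_const x)).congr_deriv ?_
  rw [map_smul, smul_eq_mul]

variable [FiniteDimensional ℝ E] [MeasurableSpace E] [BorelSpace E]

theorem hasDerivAt_integral_sphere_comp_smul_mul_comp_smul (ν : Measure (sphere (0 : E) 1))
    [IsFiniteMeasure ν] {R : ℝ} {u v : E → ℝ} (hu : ContDiffOn ℝ 1 u (ball 0 R))
    (hv : ContDiffOn ℝ 1 v (ball 0 R)) {α β α' β' : ℝ → ℝ} (hα : ∀ t, HasDerivAt α (α' t) t)
    (hβ : ∀ t, HasDerivAt β (β' t) t) (hα' : Continuous α') (hβ' : Continuous β') {t : ℝ}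
    (hαt : α t ∈ Ioo (-R) R) (hβt : β t ∈ Ioo (-R) R) :
    HasDerivAt (fun r => ∫ ω : sphere (0 : E) 1, u (α r • (ω : E)) * v (β r • (ω : E)) ∂ν)
      (∫ ω : sphere (0 : E) 1, (α' t * fderiv ℝ u (α t • (ω : E)) ω * v (β t • (ω : E))
        + u (α t • (ω : E)) * (β' t * fderiv ℝ v (β t • (ω : E)) ω)) ∂ν) t := by
  have hαc : Continuous α := continuous_iff_continuousAt.2 fun t => (hα t).continuousAt
  have hβc : Continuous β := continuous_iff_continuousAt.2 fun t => (hβ t).continuousAt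
  set I : Set ℝ := α ⁻¹' Ioo (-R) R ∩ β ⁻¹' Ioo (-R) R
  have hI : IsOpen I := (isOpen_Ioo.preimage hαc).inter (isOpen_Ioo.preimage hβc)
  have hαI : MapsTo α I (Ioo (-R) R) := fun r hr => hr.1
  have hβI : MapsTo β I (Ioo (-R) R) := fun r hr => hr.2
  have hdiff {w : E → ℝ} (hw : ContDiffOn ℝ 1 w (ball 0 R)) {a} (ha : a ∈ Ioo (-R) R)
      (ω : sphere (0 : E) 1) : DifferentiableAt ℝ w (a • (ω : E)) :=
    (hw.differentiableOn one_ne_zero).differentiableAt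
      (isOpen_ball.mem_nhds (smul_sphere_mem_ball ha ω))
  have hu₀ := continuousOn_comp_smul_sphere hu.continuousOn hαc hαI
  have hv₀ := continuousOn_comp_smul_sphere hv.continuousOn hβc hβI
  refine hasDerivAt_integral_of_continuousOn_prod ν (s := I) hI
    (f' := fun r (ω : sphere (0 : E) 1) =>
      α' r * fderiv ℝ u (α r • (ω : E)) ω * v (β r • (ω : E))
        + u (α r • (ω : E)) * (β' r * fderiv ℝ v (β r • (ω : E)) ω))
    (fun r hr => ?_) ?_ (fun r hr ω => ?_) ⟨hαt, hβt⟩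
  · exact (hu₀.mul hv₀).comp_continuous (by fun_prop : Continuous fun ω => (r, ω))
      fun ω => ⟨hr, mem_univ ω⟩
  · have hω : Continuous fun p : ℝ × sphere (0 : E) 1 => (p.2 : E) := by fun_prop
    have hu₁ := (continuousOn_comp_smul_sphere
      (hu.continuousOn_fderiv_of_isOpen isOpen_ball le_rfl) hαc hαI).clm_apply hω.continuousOn
    have hv₁ := (continuousOn_comp_smul_sphere
      (hv.continuousOn_fderiv_of_isOpen isOpen_ball le_rfl) hβc hβI).clm_apply hω.continuousOn
    exact (((hα'.comp continuous_fst).continuousOn.mul hu₁).mul hv₀).add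
      (hu₀.mul ((hβ'.comp continuous_fst).continuousOn.mul hv₁))
  · exact (hasDerivAt_comp_smul (hdiff hu hr.1 ω) (hα r)).mul
      (hasDerivAt_comp_smul (hdiff hv hr.2 ω) (hβ r))

variable [Nontrivial E] (μ : Measure E) [μ.IsAddHaarMeasure]

theorem integral_sphere_green_smul {R a b : ℝ} {u v : E → ℝ} (hu : HarmonicOnNhd u (ball 0 R))
    (hv : HarmonicOnNhd v (ball 0 R)) (ha : a ∈ Ioo 0 R) (hb : b ∈ Ioo 0 R) :
    ∫ ω : sphere (0 : E) 1, (a * fderiv ℝ u (a • (ω : E)) ω * v (b • (ω : E))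
      - u (a • (ω : E)) * (b * fderiv ℝ v (b • (ω : E)) ω)) ∂μ.toSphere = 0 := by
  have hmax : 0 < max a b := lt_max_of_lt_left ha.1
  have hone : 1 < R / max a b := (one_lt_div hmax).2 (max_lt ha.2 hb.2)
  have hdil {w : E → ℝ} (hw : HarmonicOnNhd w (ball 0 R)) {t : ℝ} (ht : 0 ≤ t)
      (htmax : t ≤ max a b) : HarmonicOnNhd (fun x => w (0 + t • x)) (ball 0 (R / max a b)) := by
    refine (harmonicOnNhd_comp_const_add_smul hw 0 t).mono fun x hx => ?_
    rw [mem_ball_zero_iff, lt_div_iff₀' hmax] at hx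
    simp only [mem_preimage, zero_add, mem_ball_zero_iff, norm_smul, Real.norm_of_nonneg ht]
    exact (mul_le_mul_of_nonneg_right htmax (norm_nonneg x)).trans_lt hx
  have hgreen := integral_sphere_green μ (hdil hu ha.1.le (le_max_left a b))
    (hdil hv hb.1.le (le_max_right a b)) ⟨one_pos, hone⟩
  simp only [fderiv_comp_const_add_smul] at hgreen
  simpa using hgreen

theorem hasDerivAt_integral_sphere_mul_exp_smul {R s : ℝ} {u v : E → ℝ}
    (hu : HarmonicOnNhd u (ball 0 R)) (hv : HarmonicOnNhd v (ball 0 R)) {t : ℝ}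
    (ht : Real.exp t < R) (hst : Real.exp (s - t) < R) :
    HasDerivAt (fun r => ∫ ω : sphere (0 : E) 1,
      u (Real.exp r • (ω : E)) * v (Real.exp (s - r) • (ω : E)) ∂μ.toSphere) 0 t := by
  have hexp (r : ℝ) : HasDerivAt (fun r => Real.exp (s - r)) (-Real.exp (s - r)) r := by
    simpa using ((hasDerivAt_id r).const_sub s).exp
  have hmem {r : ℝ} (hr : Real.exp r < R) : Real.exp r ∈ Ioo (-R) R :=
    ⟨by linarith [Real.exp_pos r], hr⟩
  refine (hasDerivAt_integral_sphere_comp_smul_mul_comp_smul μ.toSphere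
    (hu.contDiffOn.of_le one_le_two) (hv.contDiffOn.of_le one_le_two) Real.hasDerivAt_exp hexp
    (by fun_prop) (by fun_prop) (hmem ht) (hmem hst)).congr_deriv ?_
  rw [← integral_sphere_green_smul μ hu hv ⟨Real.exp_pos t, ht⟩ ⟨Real.exp_pos (s - t), hst⟩]
  refine integral_congr_ae (.of_forall fun ω => ?_)
  ring

theorem integral_sphere_mul_smul_comm_of_harmonicOnNhd {R a b : ℝ} {u v : E → ℝ}
    (hu : HarmonicOnNhd u (ball 0 R)) (hv : HarmonicOnNhd v (ball 0 R)) (ha : a ∈ Ioo 0 R)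
    (hb : b ∈ Ioo 0 R) :
    ∫ ω : sphere (0 : E) 1, u (a • (ω : E)) * v (b • (ω : E)) ∂μ.toSphere
      = ∫ ω : sphere (0 : E) 1, u (b • (ω : E)) * v (a • (ω : E)) ∂μ.toSphere := by
  have hR : 0 < R := ha.1.trans ha.2
  set s := Real.log a + Real.log b with hs
  have haI : Real.log a ∈ Ioo (s - Real.log R) (Real.log R) := by
    constructor <;> linarith [Real.log_lt_log ha.1 ha.2, Real.log_lt_log hb.1 hb.2]
  have hbI : Real.log b ∈ Ioo (s - Real.log R) (Real.log R) := by
    constructor <;> linarith [Real.log_lt_log ha.1 ha.2, Real.log_lt_log hb.1 hb.2]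
  have hderiv (t) (ht : t ∈ Ioo (s - Real.log R) (Real.log R)) :=
    hasDerivAt_integral_sphere_mul_exp_smul μ hu hv ((Real.lt_log_iff_exp_lt hR).1 ht.2)
      ((Real.lt_log_iff_exp_lt hR).1 (sub_lt_comm.1 ht.1))
  simpa [hs, Real.exp_log ha.1, Real.exp_log hb.1] using
    isOpen_Ioo.is_const_of_deriv_eq_zero isPreconnected_Ioo
      (fun t ht => (hderiv t ht).differentiableAt.differentiableWithinAt)
      (fun t ht => (hderiv t ht).deriv) haI hbI

theorem average_sphere_eq_of_harmonicOnNhd {R ρ : ℝ} {u : E → ℝ} (hu : HarmonicOnNhd u (ball 0 R))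
    (hρ : ρ ∈ Ioo 0 R) : ⨍ ω : sphere (0 : E) 1, u (ρ • (ω : E)) ∂μ.toSphere = u 0 := by
  have hR : 0 < R := hρ.1.trans hρ.2
  have hconst : ∀ᶠ t in 𝓝[>] (0 : ℝ), ∫ ω : sphere (0 : E) 1, u (t • (ω : E)) ∂μ.toSphere
      = ∫ ω : sphere (0 : E) 1, u (ρ • (ω : E)) ∂μ.toSphere := by
    filter_upwards [Ioo_mem_nhdsGT hR] with t ht
    simpa using integral_sphere_mul_smul_comm_of_harmonicOnNhd μ hu (harmonicOnNhd_const 1) ht hρ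
  have hlim : Tendsto (fun t : ℝ => ∫ ω : sphere (0 : E) 1, u (t • (ω : E)) ∂μ.toSphere) (𝓝[>] 0)
      (𝓝 (∫ ω : sphere (0 : E) 1, u ((0 : ℝ) • (ω : E)) ∂μ.toSphere)) :=
    ((continuousOn_integral_sphere μ hu.continuousOn).continuousAt
      (Ioo_mem_nhds (neg_neg_of_pos hR) hR)).mono_left nhdsWithin_le_nhds
  have hint := tendsto_nhds_unique (hlim.congr' hconst) tendsto_const_nhds
  have : NeZero μ.toSphere := ⟨μ.toSphere_ne_zero⟩
  simp only [zero_smul] at hint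
  rw [average_eq, ← hint, ← average_eq, average_const]

end Swap

section PoissonKernel

variable {E : Type*} [NormedAddCommGroup E] [InnerProductSpace ℝ E]

theorem hasGradientAt_norm_sub_sq [CompleteSpace E] (e x : E) :
    HasGradientAt (fun y => ‖y - e‖ ^ 2) ((2 : ℝ) • (x - e)) x := by
  rw [hasGradientAt_iff_hasFDerivAt]
  refine ((hasFDerivAt_id x).sub_const e).norm_sq.congr_fderiv ?_
  ext y
  simp

theorem hasGradientAt_norm_sub_sq_rpow [CompleteSpace E] {e x : E} (hx : x ≠ e) (p : ℝ) :
    HasGradientAt (fun y => (‖y - e‖ ^ 2) ^ p)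
      ((2 * p * (‖x - e‖ ^ 2) ^ (p - 1)) • (x - e)) x := by
  have hne : ‖x - e‖ ^ 2 ≠ 0 := by simpa [sub_eq_zero] using hx
  rw [hasGradientAt_iff_hasFDerivAt]
  refine ((hasGradientAt_norm_sub_sq e x).hasFDerivAt.rpow_const (Or.inl hne)).congr_fderiv ?_
  ext y
  simp
  ring

theorem hasGradientAt_one_sub_norm_sq [CompleteSpace E] (x : E) :
    HasGradientAt (fun y => 1 - ‖y‖ ^ 2) ((-2 : ℝ) • x) x := by
  rw [hasGradientAt_iff_hasFDerivAt]
  refine ((hasFDerivAt_id x).norm_sq.const_sub 1).congr_fderiv ?_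
  ext y
  simp

theorem contDiffAt_norm_sub_sq_rpow {e x : E} (hx : x ≠ e) (p : ℝ) {n : WithTop ℕ∞} :
    ContDiffAt ℝ n (fun y => (‖y - e‖ ^ 2) ^ p) x :=
  ((contDiffAt_id.sub contDiffAt_const).norm_sq ℝ).rpow_const_of_ne
    (by simpa [sub_eq_zero] using hx)

/-- The Poisson kernel of the unit ball with pole `e` on the unit sphere, normalised to take the
value `1` at the origin; it is the density of harmonic measure with respect to the rotation
invariant probability measure on the sphere. -/
noncomputable def unitBallPoissonKernel (e x : E) : ℝ :=
  (1 - ‖x‖ ^ 2) / ‖x - e‖ ^ finrank ℝ E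

theorem unitBallPoissonKernel_eq_rpow (e x : E) :
    unitBallPoissonKernel e x
      = (1 - ‖x‖ ^ 2) * (‖x - e‖ ^ 2) ^ (-(finrank ℝ E : ℝ) / 2) := by
  rw [unitBallPoissonKernel, div_eq_mul_inv, ← Real.rpow_natCast ‖x - e‖ 2,
    ← Real.rpow_natCast ‖x - e‖ (finrank ℝ E), ← Real.rpow_mul (norm_nonneg _),
    ← Real.rpow_neg (norm_nonneg _)]
  push_cast
  ring_nf

variable [FiniteDimensional ℝ E]

theorem laplacian_norm_sub_sq_rpow {e x : E} (hx : x ≠ e) (p : ℝ) :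
    Δ (fun y => (‖y - e‖ ^ 2) ^ p) x
      = 2 * p * (2 * p - 2 + finrank ℝ E) * (‖x - e‖ ^ 2) ^ (p - 1) := by
  have hpos : 0 < ‖x - e‖ ^ 2 := by have := norm_sub_pos_iff.2 hx; positivity
  have hgrad : ∇ (fun y => (‖y - e‖ ^ 2) ^ p)
      =ᶠ[𝓝 x] fun y => (2 * p * (‖y - e‖ ^ 2) ^ (p - 1)) • (y - e) := by
    filter_upwards [isOpen_ne.mem_nhds hx] with y hy
    exact (hasGradientAt_norm_sub_sq_rpow hy p).gradient
  have hcoeff : HasGradientAt (fun y => 2 * p * (‖y - e‖ ^ 2) ^ (p - 1))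
      ((2 * p) • (2 * (p - 1) * (‖x - e‖ ^ 2) ^ (p - 1 - 1)) • (x - e)) x :=
    ((hasGradientAt_norm_sub_sq_rpow hx (p - 1)).hasFDerivAt.const_mul (2 * p)).congr_fderiv
      (map_smul (toDual ℝ E) _ _).symm
  rw [laplacian_eq_divergence_gradient (contDiffAt_norm_sub_sq_rpow hx p),
    divergence_congr_nhds hgrad, divergence_smul hcoeff.differentiableAt (by fun_prop),
    hcoeff.gradient, divergence_sub_const]
  have hpow : (‖x - e‖ ^ 2) ^ (p - 1) = (‖x - e‖ ^ 2) ^ (p - 1 - 1) * ‖x - e‖ ^ 2 := by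
    rw [← Real.rpow_add_one hpos.ne', sub_add_cancel]
  simp only [inner_smul_left, real_inner_self_eq_norm_sq, hpow]
  simp
  ring

theorem laplacian_one_sub_norm_sq (x : E) :
    Δ (fun y : E => (1 - ‖y‖ ^ 2 : ℝ)) x = -2 * (finrank ℝ E : ℝ) := by
  have hgrad : ∇ (fun y : E => 1 - ‖y‖ ^ 2) = fun y => (-2 : ℝ) • y :=
    funext fun y => (hasGradientAt_one_sub_norm_sq y).gradient
  rw [laplacian_eq_divergence_gradient (contDiff_const.sub (contDiff_norm_sq ℝ)).contDiffAt, hgrad,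
    divergence, fderiv_fun_const_smul differentiableAt_fun_id, fderiv_fun_id]
  simp

theorem laplacian_unitBallPoissonKernel {e x : E} (he : ‖e‖ = 1) (hx : x ≠ e) :
    Δ (unitBallPoissonKernel e) x = 0 := by
  set n : ℝ := (finrank ℝ E : ℝ) with hn
  have hpos : 0 < ‖x - e‖ ^ 2 := by have := norm_sub_pos_iff.2 hx; positivity
  have hpow : (‖x - e‖ ^ 2) ^ (-n / 2) = (‖x - e‖ ^ 2) ^ (-n / 2 - 1) * ‖x - e‖ ^ 2 := by
    rw [← Real.rpow_add_one hpos.ne', sub_add_cancel]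
  have hinner : 2 * ⟪x, x - e⟫_ℝ = ‖x‖ ^ 2 + ‖x - e‖ ^ 2 - 1 := by
    have h := norm_sub_sq_real x (x - e)
    rw [sub_sub_cancel, he] at h
    linarith
  rw [funext (unitBallPoissonKernel_eq_rpow e),
    laplacian_mul (contDiff_const.sub (contDiff_norm_sq ℝ)).contDiffAt
      (contDiffAt_norm_sub_sq_rpow hx _), laplacian_norm_sub_sq_rpow hx,
    laplacian_one_sub_norm_sq, (hasGradientAt_one_sub_norm_sq x).gradient,
    (hasGradientAt_norm_sub_sq_rpow hx _).gradient, ← hn, hpow]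
  simp only [inner_smul_left, inner_smul_right, conj_trivial]
  linear_combination 2 * n * (‖x - e‖ ^ 2) ^ (-n / 2 - 1) * hinner

theorem harmonicOnNhd_unitBallPoissonKernel {e : E} (he : ‖e‖ = 1) :
    HarmonicOnNhd (unitBallPoissonKernel e) {e}ᶜ := by
  refine fun x hx => ⟨?_, ?_⟩
  · rw [funext (unitBallPoissonKernel_eq_rpow e)]
    exact (contDiff_const.sub (contDiff_norm_sq ℝ)).contDiffAt.mul
      (contDiffAt_norm_sub_sq_rpow hx _)
  · filter_upwards [isOpen_compl_singleton.mem_nhds hx] with y hy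
    exact laplacian_unitBallPoissonKernel he hy

theorem harmonicOnNhd_ball_unitBallPoissonKernel {e : E} (he : ‖e‖ = 1) :
    HarmonicOnNhd (unitBallPoissonKernel e) (ball 0 1) :=
  (harmonicOnNhd_unitBallPoissonKernel he).mono fun x hx hxe =>
    (mem_ball_zero_iff.1 hx).ne (by rw [mem_singleton_iff.1 hxe, he])

end PoissonKernel

section PoissonIntegral

variable {E : Type*} [NormedAddCommGroup E] [InnerProductSpace ℝ E]

theorem unitBallPoissonKernel_zero {e : E} (he : ‖e‖ = 1) : unitBallPoissonKernel e 0 = 1 := by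
  simp [unitBallPoissonKernel, he]

theorem unitBallPoissonKernel_nonneg (e : E) {x : E} (hx : ‖x‖ ≤ 1) :
    0 ≤ unitBallPoissonKernel e x :=
  div_nonneg (by nlinarith [norm_nonneg x]) (by positivity)

theorem norm_sub_le_two_mul_norm_smul_sub {ρ : ℝ} (hρ : ρ ∈ Icc 0 1) (e ω : sphere (0 : E) 1) :
    ‖(ω - e : E)‖ ≤ 2 * ‖ρ • (ω : E) - e‖ := by
  have h₁ : ‖(ω : E) - ρ • (ω : E)‖ = 1 - ρ := by
    rw [← one_smul ℝ (ω : E), smul_smul, ← sub_smul, norm_smul]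
    simp [hρ.2]
  have h₂ : 1 - ρ ≤ ‖ρ • (ω : E) - e‖ := by
    simpa [norm_smul, abs_of_nonneg hρ.1, norm_sub_rev] using norm_sub_norm_le (e : E) (ρ • (ω : E))
  linarith [norm_sub_le_norm_sub_add_norm_sub (ω : E) (ρ • (ω : E)) e]

theorem tendstoUniformlyOn_unitBallPoissonKernel_smul (e : sphere (0 : E) 1)
    {δ : ℝ} (hδ : 0 < δ) :
    TendstoUniformlyOn (fun ρ (ω : sphere (0 : E) 1) => unitBallPoissonKernel (e : E) (ρ • (ω : E)))
      0 (𝓝[<] (1 : ℝ)) (ball e δ)ᶜ := by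
  have hlim : Tendsto (fun ρ : ℝ => (1 - ρ ^ 2) / (δ / 2) ^ finrank ℝ E) (𝓝[<] 1) (𝓝 0) := by
    have hcont : Continuous fun ρ : ℝ => (1 - ρ ^ 2) / (δ / 2) ^ finrank ℝ E := by fun_prop
    simpa using (hcont.tendsto 1).mono_left nhdsWithin_le_nhds
  refine tendstoUniformlyOn_iff.2 fun ε hε => ?_
  filter_upwards [hlim.eventually_lt_const hε, Ioo_mem_nhdsLT zero_lt_one] with ρ hρε hρ ω hω
  have hnorm : ‖ρ • (ω : E)‖ = ρ := by simp [norm_smul, abs_of_pos hρ.1]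
  have hdist : δ / 2 ≤ ‖ρ • (ω : E) - e‖ := by
    have hδω : δ ≤ ‖(ω - e : E)‖ := by simpa [Subtype.dist_eq, dist_eq_norm] using hω
    linarith [norm_sub_le_two_mul_norm_smul_sub (Ioo_subset_Icc_self hρ) e ω]
  rw [Pi.zero_apply, dist_zero_left, Real.norm_of_nonneg
    (unitBallPoissonKernel_nonneg _ (hnorm.trans_le hρ.2.le)), unitBallPoissonKernel, hnorm]
  refine (div_le_div_of_nonneg_left ?_ (by positivity) (by gcongr)).trans_lt hρε
  nlinarith [hρ.1, hρ.2]

variable [FiniteDimensional ℝ E]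

theorem continuous_unitBallPoissonKernel_smul (e : sphere (0 : E) 1) {c : ℝ}
    (hc : c ∈ Ioo (-1) 1) :
    Continuous fun ω : sphere (0 : E) 1 => unitBallPoissonKernel (e : E) (c • (ω : E)) :=
  (harmonicOnNhd_ball_unitBallPoissonKernel
    (norm_eq_of_mem_sphere e)).continuousOn.comp_continuous (by fun_prop) (smul_sphere_mem_ball hc)

variable [Nontrivial E] [MeasurableSpace E] [BorelSpace E] (μ : Measure E) [μ.IsAddHaarMeasure]

theorem average_unitBallPoissonKernel_smul {e : E} (he : ‖e‖ = 1) {ρ : ℝ} (hρ : ρ ∈ Ioo 0 1) :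
    ⨍ ω : sphere (0 : E) 1, unitBallPoissonKernel e (ρ • (ω : E)) ∂μ.toSphere = 1 := by
  rw [average_sphere_eq_of_harmonicOnNhd μ (harmonicOnNhd_ball_unitBallPoissonKernel he) hρ,
    unitBallPoissonKernel_zero he]

theorem tendsto_average_unitBallPoissonKernel_smul_mul (e : sphere (0 : E) 1)
    {g : sphere (0 : E) 1 → ℝ} (hg : Continuous g) :
    Tendsto (fun ρ : ℝ => ⨍ ω : sphere (0 : E) 1,
      unitBallPoissonKernel (e : E) (ρ • (ω : E)) * g ω ∂μ.toSphere) (𝓝[<] 1) (𝓝 (g e)) := by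
  have : NeZero μ.toSphere := ⟨μ.toSphere_ne_zero⟩
  have hρ : ∀ᶠ ρ : ℝ in 𝓝[<] 1, ρ ∈ Ioo 0 1 := Ioo_mem_nhdsLT zero_lt_one
  simp only [average, ← smul_eq_mul]
  refine tendsto_integral_peak_smul_of_integrable_of_tendsto (t := univ) (x₀ := e)
    MeasurableSet.univ univ_mem (measure_ne_top _ _) ?_ ?_ ?_ ?_
    (hg.integrable_of_hasCompactSupport (HasCompactSupport.of_compactSpace _)) (hg.tendsto e)
  · filter_upwards [hρ] with ρ hρ ω
    exact unitBallPoissonKernel_nonneg _ (by simp [norm_smul, abs_of_pos hρ.1, hρ.2.le])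
  · intro U hU heU
    obtain ⟨δ, hδ, hball⟩ := Metric.isOpen_iff.1 hU e heU
    exact (tendstoUniformlyOn_unitBallPoissonKernel_smul e hδ).mono (compl_subset_compl.2 hball)
  · refine tendsto_const_nhds.congr' ?_
    filter_upwards [hρ] with ρ hρ
    rw [setIntegral_univ]
    exact (average_unitBallPoissonKernel_smul μ (norm_eq_of_mem_sphere e) hρ).symm
  · filter_upwards [hρ] with ρ hρ
    exact (continuous_unitBallPoissonKernel_smul e
      ⟨by linarith [hρ.1], hρ.2⟩).aestronglyMeasurable

theorem tendsto_average_sphere_mul_unitBallPoissonKernel {u : E → ℝ}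
    (hu : HarmonicOnNhd u (ball 0 1)) {c : ℝ} (hc : c ∈ Ioo 0 1) (e : sphere (0 : E) 1) :
    Tendsto (fun ρ : ℝ => ⨍ ω : sphere (0 : E) 1,
      u (ρ • (ω : E)) * unitBallPoissonKernel (e : E) (c • (ω : E)) ∂μ.toSphere)
      (𝓝[<] 1) (𝓝 (u (c • (e : E)))) := by
  have hcont : Continuous fun ω : sphere (0 : E) 1 => u (c • (ω : E)) :=
    hu.continuousOn.comp_continuous (by fun_prop)
      (smul_sphere_mem_ball ⟨by linarith [hc.1], hc.2⟩)
  refine (tendsto_average_unitBallPoissonKernel_smul_mul μ e hcont).congr' ?_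
  filter_upwards [Ioo_mem_nhdsLT zero_lt_one] with ρ hρ
  rw [average_eq, average_eq, integral_sphere_mul_smul_comm_of_harmonicOnNhd μ hu
    (harmonicOnNhd_ball_unitBallPoissonKernel (norm_eq_of_mem_sphere e)) hρ hc]
  simp only [mul_comm]

end PoissonIntegral

section Harnack

variable {E : Type*} [NormedAddCommGroup E] [InnerProductSpace ℝ E] [FiniteDimensional ℝ E]

section Nontrivial

variable [Nontrivial E]

theorem le_unitBallPoissonKernel {e x : E} (he : ‖e‖ = 1) {s : ℝ} (hx : ‖x‖ ≤ s) (hs : s < 1) :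
    (1 - s) / (1 + s) ^ (finrank ℝ E - 1) ≤ unitBallPoissonKernel e x := by
  have hlower : 1 - ‖x‖ ≤ ‖x - e‖ := by simpa [he, norm_sub_rev] using norm_sub_norm_le e x
  have hupper : ‖x - e‖ ≤ 1 + ‖x‖ := by simpa [he, add_comm] using norm_sub_le x e
  have hpos : 0 < ‖x - e‖ := by linarith
  obtain ⟨k, hk⟩ := Nat.exists_eq_succ_of_ne_zero (finrank_pos (R := ℝ) (M := E)).ne'
  rw [unitBallPoissonKernel, hk, Nat.succ_sub_one, pow_succ]
  calc (1 - s) / (1 + s) ^ k ≤ (1 - ‖x‖) / ‖x - e‖ ^ k := by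
        gcongr <;> linarith
    _ = (1 - ‖x‖) * ‖x - e‖ / (‖x - e‖ ^ k * ‖x - e‖) := by field_simp
    _ ≤ (1 - ‖x‖ ^ 2) / (‖x - e‖ ^ k * ‖x - e‖) := by
        gcongr
        nlinarith

theorem unitBallPoissonKernel_le {e x : E} (he : ‖e‖ = 1) {s : ℝ} (hx : ‖x‖ ≤ s) (hs : s < 1) :
    unitBallPoissonKernel e x ≤ (1 + s) / (1 - s) ^ (finrank ℝ E - 1) := by
  have hlower : 1 - ‖x‖ ≤ ‖x - e‖ := by simpa [he, norm_sub_rev] using norm_sub_norm_le e x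
  have hpos : 0 < ‖x - e‖ := by linarith
  obtain ⟨k, hk⟩ := Nat.exists_eq_succ_of_ne_zero (finrank_pos (R := ℝ) (M := E)).ne'
  rw [unitBallPoissonKernel, hk, Nat.succ_sub_one, pow_succ]
  calc (1 - ‖x‖ ^ 2) / (‖x - e‖ ^ k * ‖x - e‖)
      ≤ (1 + ‖x‖) * ‖x - e‖ / (‖x - e‖ ^ k * ‖x - e‖) := by
        gcongr
        nlinarith [norm_nonneg x]
    _ = (1 + ‖x‖) / ‖x - e‖ ^ k := by field_simp
    _ ≤ (1 + s) / (1 - s) ^ k := by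
        gcongr <;> linarith [norm_nonneg x]

theorem mem_Icc_of_unitBallPoissonKernel_mem_Icc {u : E → ℝ}
    (hu : HarmonicOnNhd u (ball 0 1)) (hu0 : ∀ x ∈ ball (0 : E) 1, 0 ≤ u x) {c m M : ℝ}
    (hc : c ∈ Ioo 0 1) (e : sphere (0 : E) 1)
    (hP : ∀ ω : sphere (0 : E) 1, unitBallPoissonKernel (e : E) (c • (ω : E)) ∈ Icc m M) :
    u (c • (e : E)) ∈ Icc (m * u 0) (M * u 0) := by
  borelize E
  have : NeZero (volume : Measure E).toSphere := ⟨Measure.toSphere_ne_zero _⟩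
  refine isClosed_Icc.mem_of_tendsto
    (tendsto_average_sphere_mul_unitBallPoissonKernel volume hu hc e) ?_
  filter_upwards [Ioo_mem_nhdsLT zero_lt_one] with ρ hρ
  have hmem (ω : sphere (0 : E) 1) : ρ • (ω : E) ∈ ball (0 : E) 1 :=
    smul_sphere_mem_ball ⟨by linarith [hρ.1], hρ.2⟩ ω
  have hcont : Continuous fun ω : sphere (0 : E) 1 => u (ρ • (ω : E)) :=
    hu.continuousOn.comp_continuous (by fun_prop) hmem
  have hcontP := continuous_unitBallPoissonKernel_smul e ⟨by linarith [hc.1], hc.2⟩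
  have hint {f : sphere (0 : E) 1 → ℝ} (hf : Continuous f) : Integrable f
      (((volume : Measure E).toSphere univ)⁻¹ • (volume : Measure E).toSphere) :=
    hf.integrable_of_hasCompactSupport (HasCompactSupport.of_compactSpace _)
  rw [← average_sphere_eq_of_harmonicOnNhd volume hu hρ, average, average, ← integral_const_mul,
    ← integral_const_mul]
  constructor
  · refine integral_mono (hint (hcont.const_mul m)) (hint (hcont.mul hcontP)) fun ω => ?_
    rw [mul_comm m]
    exact mul_le_mul_of_nonneg_left (hP ω).1 (hu0 _ (hmem ω))
  · refine integral_mono (hint (hcont.mul hcontP)) (hint (hcont.const_mul M)) fun ω => ?_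
    rw [mul_comm M]
    exact mul_le_mul_of_nonneg_left (hP ω).2 (hu0 _ (hmem ω))

theorem harnack_bounds_unitBall {u : E → ℝ} (hu : HarmonicOnNhd u (ball 0 1))
    (hu0 : ∀ x ∈ ball (0 : E) 1, 0 ≤ u x) {s : ℝ} (hs : s < 1) {z : E} (hz : z ∈ closedBall 0 s) :
    u z ∈ Icc ((1 - s) / (1 + s) ^ (finrank ℝ E - 1) * u 0)
      ((1 + s) / (1 - s) ^ (finrank ℝ E - 1) * u 0) := by
  rw [mem_closedBall_zero_iff] at hz
  have hbounds {e x : E} (he : ‖e‖ = 1) (hx : ‖x‖ ≤ s) :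
      unitBallPoissonKernel e x ∈ Icc ((1 - s) / (1 + s) ^ (finrank ℝ E - 1))
        ((1 + s) / (1 - s) ^ (finrank ℝ E - 1)) :=
    ⟨le_unitBallPoissonKernel he hx hs, unitBallPoissonKernel_le he hx hs⟩
  obtain rfl | hz0 := eq_or_ne z 0
  · obtain ⟨e, he⟩ := exists_norm_eq E zero_le_one
    have hone := hbounds he hz
    rw [unitBallPoissonKernel_zero he] at hone
    have hnonneg := hu0 0 (mem_ball_self one_pos)
    exact ⟨mul_le_of_le_one_left hnonneg hone.1, le_mul_of_one_le_left hnonneg hone.2⟩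
  · have hpolar : ‖z‖ • ‖z‖⁻¹ • z = z := smul_inv_smul₀ (norm_ne_zero_iff.2 hz0) z
    have hmem := mem_Icc_of_unitBallPoissonKernel_mem_Icc hu hu0
      ⟨norm_pos_iff.2 hz0, hz.trans_lt hs⟩ ⟨‖z‖⁻¹ • z, by simp [norm_smul, hz0]⟩
      fun ω => hbounds (by simp [norm_smul, hz0]) (by simpa [norm_smul] using hz)
    rwa [hpolar] at hmem

theorem harnack_unitBall {u : E → ℝ} (hu : HarmonicOnNhd u (ball 0 1))
    (hu0 : ∀ x ∈ ball (0 : E) 1, 0 ≤ u x) {s : ℝ} (hs : s < 1) {z w : E}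
    (hz : z ∈ closedBall 0 s) (hw : w ∈ closedBall 0 s) :
    u z ≤ ((1 + s) / (1 - s)) ^ finrank ℝ E * u w := by
  have hs0 : 0 ≤ s := nonempty_closedBall.1 ⟨z, hz⟩
  have hs1 : 0 < 1 - s := sub_pos.2 hs
  obtain ⟨k, hk⟩ := Nat.exists_eq_succ_of_ne_zero (finrank_pos (R := ℝ) (M := E)).ne'
  calc u z ≤ (1 + s) / (1 - s) ^ (finrank ℝ E - 1) * u 0 :=
        (harnack_bounds_unitBall hu hu0 hs hz).2
    _ = ((1 + s) / (1 - s)) ^ finrank ℝ E * ((1 - s) / (1 + s) ^ (finrank ℝ E - 1) * u 0) := by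
        rw [hk, Nat.succ_sub_one, div_pow, pow_succ, pow_succ]
        field_simp
    _ ≤ ((1 + s) / (1 - s)) ^ finrank ℝ E * u w := by
        gcongr
        exact (harnack_bounds_unitBall hu hu0 hs hw).1

end Nontrivial

theorem harnack_ball {u : E → ℝ} {y : E} {ρ : ℝ} (hρ : 0 < ρ)
    (hu : HarmonicOnNhd u (ball y ρ)) (hu0 : ∀ x ∈ ball y ρ, 0 ≤ u x) {s : ℝ} (hs : s < 1)
    {z w : E} (hz : z ∈ closedBall y (s * ρ)) (hw : w ∈ closedBall y (s * ρ)) :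
    u z ≤ ((1 + s) / (1 - s)) ^ finrank ℝ E * u w := by
  obtain hE | hE := subsingleton_or_nontrivial E
  · simp [Subsingleton.elim z w, finrank_zero_of_subsingleton]
  have hmaps {x : E} (hx : x ∈ ball 0 1) : y + ρ • x ∈ ball y ρ := by
    rw [mem_ball_zero_iff] at hx
    simpa [norm_smul, abs_of_pos hρ] using mul_lt_mul_of_pos_left hx hρ
  have hrescale {x : E} (hx : x ∈ closedBall y (s * ρ)) : ρ⁻¹ • (x - y) ∈ closedBall 0 s := by
    rw [mem_closedBall_iff_norm] at hx
    rwa [mem_closedBall_zero_iff, norm_smul, norm_inv, Real.norm_of_nonneg hρ.le,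
      inv_mul_le_iff₀ hρ, mul_comm]
  have hunit := harnack_unitBall
    ((harmonicOnNhd_comp_const_add_smul hu y ρ).mono fun x hx => hmaps hx)
    (fun x hx => hu0 _ (hmaps hx)) hs (hrescale hz) (hrescale hw)
  simpa [smul_inv_smul₀ hρ.ne'] using hunit

end Harnack

section HarnackFunction

variable {n : ℕ}

theorem isProperSubdomain_ball [Nonempty (Fin n)] (x : EuclideanSpace ℝ (Fin n)) {r : ℝ}
    (hr : 0 < r) : IsProperSubdomain (ball x r) :=
  ⟨isOpen_ball, isConnected_ball hr, fun h =>
    NormedSpace.unbounded_univ ℝ (EuclideanSpace ℝ (Fin n)) (h ▸ isBounded_ball)⟩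

theorem IsHarnackFunction.mono {G : Set (EuclideanSpace ℝ (Fin n))}
    {u : EuclideanSpace ℝ (Fin n) → ℝ} {C C' : ℝ → ℝ} (hu : IsHarnackFunction G C u)
    (hC : ∀ s ∈ Ioo (0 : ℝ) 1, C s ≤ C' s) : IsHarnackFunction G C' u := fun s hs =>
  { hu s hs with
    one_le := (hu s hs).one_le.trans (hC s hs)
    max_le_mul_min := fun y ρ hρ hball => by
      obtain ⟨M, m, hM, hm, hMm⟩ := (hu s hs).max_le_mul_min y ρ hρ hball
      have hsub : closedBall y (s * ρ) ⊆ ball y ρ :=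
        closedBall_subset_ball (mul_lt_of_lt_one_left hρ hs.2)
      have hm0 : 0 ≤ m := by
        obtain ⟨w, hw, rfl⟩ := hm.1
        exact (hu s hs).nonneg w (hball (hsub hw))
      exact ⟨M, m, hM, hm, hMm.trans (mul_le_mul_of_nonneg_right (hC s hs) hm0)⟩ }

end HarnackFunction

theorem one_le_one_add_div_one_sub_pow (n : ℕ) {s : ℝ} (hs : s ∈ Ico 0 1) :
    1 ≤ ((1 + s) / (1 - s)) ^ n :=
  one_le_pow₀ ((one_le_div (sub_pos.2 hs.2)).2 (by linarith [hs.1]))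

theorem one_add_div_one_sub_pow_le (n : ℕ) {s : ℝ} (hs : s ∈ Ico 0 1) :
    ((1 + s) / (1 - s)) ^ n ≤ 1 / (1 - s ^ 2) * ((1 + s) / (1 - s)) ^ n := by
  have hone : 1 ≤ 1 / (1 - s ^ 2) := by
    rw [one_le_div] <;> nlinarith [hs.1, hs.2]
  exact le_mul_of_one_le_left (zero_le_one.trans (one_le_one_add_div_one_sub_pow n hs)) hone

theorem mainTheorem10_general {n : ℕ} {G : Set (EuclideanSpace ℝ (Fin n))}
    (hG : IsProperSubdomain G) {u : EuclideanSpace ℝ (Fin n) → ℝ} (hu : HarmonicOnNhd u G)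
    (hu0 : ∀ y ∈ G, 0 ≤ u y) :
    IsHarnackFunction G (fun s : ℝ => ((1 + s) / (1 - s)) ^ n) u := by
  refine fun s hs => ⟨hG, hu.continuousOn, hu0, hs,
    one_le_one_add_div_one_sub_pow n (Ioo_subset_Ico_self hs), fun y ρ hρ hball => ?_⟩
  have hsub : closedBall y (s * ρ) ⊆ G :=
    (closedBall_subset_ball (mul_lt_of_lt_one_left hρ hs.2)).trans hball
  have hcompact : IsCompact (u '' closedBall y (s * ρ)) :=
    (isCompact_closedBall y (s * ρ)).image_of_continuousOn (hu.continuousOn.mono hsub)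
  have hne : (u '' closedBall y (s * ρ)).Nonempty :=
    (nonempty_closedBall.2 (mul_pos hs.1 hρ).le).image u
  obtain ⟨M, hM⟩ := hcompact.exists_isGreatest hne
  obtain ⟨m, hm⟩ := hcompact.exists_isLeast hne
  obtain ⟨z, hz, hzM⟩ := hM.1
  obtain ⟨w, hw, hwm⟩ := hm.1
  refine ⟨M, m, hM, hm, ?_⟩
  rw [← hzM, ← hwm]
  simpa only [finrank_euclideanSpace_fin] using
    harnack_ball hρ (hu.mono hball) (fun v hv => hu0 v (hball hv)) hs.2 hz hw

theorem mainTheorem10 (n : ℕ) (hn : 2 ≤ n) (x : EuclideanSpace ℝ (Fin n)) (r : ℝ) (hr : 0 < r)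
    (u : EuclideanSpace ℝ (Fin n) → ℝ)
    (hu : InnerProductSpace.HarmonicOnNhd u (Metric.ball x r))
    (hpos : ∀ y ∈ Metric.ball x r, 0 < u y) :
    IsHarnackFunction (Metric.ball x r)
      (fun s : ℝ => 1 / (1 - s ^ 2) * ((1 + s) / (1 - s)) ^ n) u := by
  have : NeZero n := ⟨by omega⟩
  exact (mainTheorem10_general (isProperSubdomain_ball x hr) hu fun y hy => (hpos y hy).le).mono
    fun s hs => one_add_div_one_sub_pow_le n (Ioo_subset_Ico_self hs)
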